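/- Let $n \geq 2$ and let $\mathbb{D}^n = \{z \in \mathbb{R}^n : |z|<1\}$ be the Poincaré ball with the hyperbolic metric $d_H$ given by $|ds| = \frac{2|dz|}{1-|z|^2}$. Let $\Gamma$ be a Kleinian group acting on $\mathbb{D}^n$, that is, a discrete group of orientation preserving isometries of $(\mathbb{D}^n, d_H)$. Write $\Gamma(0) = \{g(0) : g \in \Gamma\}$ and let $L(\Gamma) = \overline{\Gamma(0)} \setminus \Gamma(0)$ (Euclidean closure) be its limit set. Assume that $\Gamma$ is non-elementary, that is, $L(\Gamma)$ contains at least $3$ points. Let $$\delta(\Gamma) = \inf\Big\{ s \geq 0 : \sum_{g \in \Gamma} \exp(-s\, d_H(0,g(0))) < \infty \Big\}$$ be the Poincaré exponent of $\Gamma$. For a non-empty bounded set $F \subseteq \mathbb{R}^n$ let $F_r$ ($r>0$) be the set of points at Euclidean distance at most $r$ from a point of $F$, let $V_E$ be $n$-dimensional Lebesgue measure, and let $$\overline{\dim}_{\mathrm{B}} F = n - \liminf_{r \to 0} \frac{\log V_E(F_r)}{\log r}$$ be the upper box dimension of $F$. Then $$\delta(\Gamma) \leq \overline{\dim}_{\mathrm{B}}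 L(\Gamma).$$ -/

import Mathlib

open Set Filter Topology MeasureTheory

noncomputable section

namespace Kleinian

/-- The Poincaré ball `{z ∈ ℝⁿ : |z| < 1}`, with the Euclidean topology
(which is also the topology of the hyperbolic metric). -/
abbrev PoincareBall (n : ℕ) : Type := Metric.ball (0 : EuclideanSpace ℝ (Fin n)) 1

/-- The centre of the Poincaré ball. -/
def origin (n : ℕ) : PoincareBall n := ⟨0, Metric.mem_ball_self one_pos⟩

/-- The length of a curve `γ : [0,1] → 𝔻ⁿ` for the line element `2|dz| / (1 - |z|²)`. -/
def hypLength {n : ℕ} (γ : ℝ → EuclideanSpace ℝ (Fin n)) : ℝ :=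
  ∫ t in (0 : ℝ)..1, 2 * ‖derivWithin γ (Icc 0 1) t‖ / (1 - ‖γ t‖ ^ 2)

/-- The hyperbolic metric on the Poincaré ball: the infimum of the lengths of the `C¹` curves
in the ball that join `x` to `y`. -/
def hypDist {n : ℕ} (x y : PoincareBall n) : ℝ :=
  sInf {ℓ : ℝ | ∃ γ : ℝ → EuclideanSpace ℝ (Fin n), ContDiffOn ℝ 1 γ (Icc 0 1) ∧
    (∀ t ∈ Icc (0 : ℝ) 1, ‖γ t‖ < 1) ∧ γ 0 = x ∧ γ 1 = y ∧ ℓ = hypLength γ}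

/-- A self-map of the ball as a map on `ℝⁿ`; the value `0` outside the ball is irrelevant for
derivatives at points of the (open) ball. -/
def toEuclidean {n : ℕ} (g : PoincareBall n → PoincareBall n) :
    EuclideanSpace ℝ (Fin n) → EuclideanSpace ℝ (Fin n) :=
  Function.extend Subtype.val (fun x => (g x : EuclideanSpace ℝ (Fin n))) 0

/-- A self-map of the ball is orientation preserving if its Jacobian determinant is positive
everywhere. (Every hyperbolic isometry is differentiable.) -/
def OrientationPreserving {n : ℕ} (g : PoincareBall n → PoincareBall n) : Prop :=
  ∀ x : PoincareBall n, ∃ A : EuclideanSpace ℝ (Fin n) →L[ℝ] EuclideanSpace ℝ (Fin n),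
    HasFDerivAt (toEuclidean g) A x ∧ 0 < A.det

theorem toEuclidean_coe {n : ℕ} (g : PoincareBall n → PoincareBall n) (x : PoincareBall n) :
    toEuclidean g x = g x :=
  Subtype.val_injective.extend_apply _ _ x

theorem eventually_ball {n : ℕ} {p : EuclideanSpace ℝ (Fin n) → Prop}
    (h : ∀ y : PoincareBall n, p y) (x : PoincareBall n) :
    ∀ᶠ y in 𝓝 (x : EuclideanSpace ℝ (Fin n)), p y :=
  Filter.mem_of_superset (Metric.isOpen_ball.mem_nhds x.2) fun y hy => h ⟨y, hy⟩

theorem OrientationPreserving.id {n : ℕ} :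
    OrientationPreserving (fun x : PoincareBall n => x) := fun x =>
  ⟨ContinuousLinearMap.id ℝ _,
    (hasFDerivAt_id _).congr_of_eventuallyEq
      (eventually_ball (fun y => toEuclidean_coe _ y) x),
    by simp [ContinuousLinearMap.det]⟩

theorem OrientationPreserving.comp {n : ℕ} {g h : PoincareBall n → PoincareBall n}
    (hg : OrientationPreserving g) (hh : OrientationPreserving h) :
    OrientationPreserving (fun x => g (h x)) := by
  intro x
  obtain ⟨B, hB, hB0⟩ := hh x
  obtain ⟨A, hA, hA0⟩ := hg (h x)
  rw [← toEuclidean_coe h x] at hA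
  refine ⟨A.comp B, (hA.comp _ hB).congr_of_eventuallyEq
    (eventually_ball (fun y => ?_) x), ?_⟩
  · simp [toEuclidean_coe]
  · have : (A.comp B).det = A.det * B.det := LinearMap.det_comp _ _
    rw [this]
    exact mul_pos hA0 hB0

theorem OrientationPreserving.symm {n : ℕ} {g : PoincareBall n ≃ₜ PoincareBall n}
    (hg : OrientationPreserving g) : OrientationPreserving g.symm := by
  intro x
  obtain ⟨A, hA, hA0⟩ := hg (g.symm x)
  have hdet := hA0.ne'
  let e := A.toContinuousLinearEquivOfDetNeZero hdet
  have he : (e : EuclideanSpace ℝ (Fin n) →L[ℝ] EuclideanSpace ℝ (Fin n)) = A :=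
    A.coe_toContinuousLinearEquivOfDetNeZero hdet
  refine ⟨e.symm, ?_, ?_⟩
  · rw [← toEuclidean_coe g.symm x, ← he] at hA
    refine HasFDerivAt.of_local_left_inverse ?_ hA
      (eventually_ball (fun y => by simp [toEuclidean_coe]) x)
    have h1 : ContinuousAt (toEuclidean g.symm ∘ Subtype.val) x := by
      have : toEuclidean g.symm ∘ Subtype.val = fun y => (g.symm y : EuclideanSpace ℝ (Fin n)) :=
        funext fun y => toEuclidean_coe _ y
      rw [this]
      exact (continuous_subtype_val.comp g.symm.continuous).continuousAt
    exact (Metric.isOpen_ball.isOpenEmbedding_subtypeVal.continuousAt_iff).1 h1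
  · have h2 : (e.symm : EuclideanSpace ℝ (Fin n) →L[ℝ] EuclideanSpace ℝ (Fin n)).det * A.det
        = 1 := by
      rw [← he]
      exact e.toLinearEquiv.det_symm_mul_det
    exact pos_of_mul_pos_left (h2 ▸ one_pos) hA0.le

/-- The group `con⁺(𝔻ⁿ)` of orientation preserving isometries of `(𝔻ⁿ, d_H)`. -/
def conPlus (n : ℕ) : Subgroup (PoincareBall n ≃ₜ PoincareBall n) where
  carrier := {g | (∀ x y, hypDist (g x) (g y) = hypDist x y) ∧ OrientationPreserving g}
  one_mem' := ⟨fun _ _ => rfl, OrientationPreserving.id⟩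
  mul_mem' := fun {g h} hg hh =>
    ⟨fun x y => (hg.1 (h x) (h y)).trans (hh.1 x y), hg.2.comp hh.2⟩
  inv_mem' := fun {g} hg =>
    ⟨fun x y => by
      have := hg.1 (g.symm x) (g.symm y)
      rw [g.apply_symm_apply, g.apply_symm_apply] at this
      exact this.symm, hg.2.symm⟩

/-- A Kleinian group: a subgroup of `con⁺(𝔻ⁿ)` that is discrete in the compact-open topology
(locally uniform convergence). -/
structure IsKleinian {n : ℕ} (Γ : Subgroup (PoincareBall n ≃ₜ PoincareBall n)) : Prop where
  le_conPlus : Γ ≤ conPlus n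
  isDiscrete : IsDiscrete ((fun g : PoincareBall n ≃ₜ PoincareBall n =>
    (g : C(PoincareBall n, PoincareBall n))) '' (Γ : Set (PoincareBall n ≃ₜ PoincareBall n)))

/-- The orbit `Γ(0)`, as a subset of `ℝⁿ`. -/
def orbit {n : ℕ} (Γ : Subgroup (PoincareBall n ≃ₜ PoincareBall n)) :
    Set (EuclideanSpace ℝ (Fin n)) :=
  {p | ∃ g ∈ Γ, p = g (origin n)}

/-- The limit set: the Euclidean closure of the orbit of `0`, minus that orbit. -/
def limitSet {n : ℕ} (Γ : Subgroup (PoincareBall n ≃ₜ PoincareBall n)) :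
    Set (EuclideanSpace ℝ (Fin n)) :=
  closure (orbit Γ) \ orbit Γ

/-- `Γ` is non-elementary if its limit set has at least three points. -/
def IsNonElementary {n : ℕ} (Γ : Subgroup (PoincareBall n ≃ₜ PoincareBall n)) : Prop :=
  3 ≤ (limitSet Γ).encard

/-- The Poincaré series `∑_{g ∈ Γ} exp(-s d_H(0, g(0)))`, with values in `[0, ∞]`. -/
def poincareSeries {n : ℕ} (Γ : Subgroup (PoincareBall n ≃ₜ PoincareBall n)) (s : ℝ) : ENNReal :=
  ∑' g : Γ, ENNReal.ofReal (Real.exp (-s * hypDist (origin n) (g.1 (origin n))))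

/-- The Poincaré exponent `inf {s ≥ 0 : P_Γ(s) < ∞}`, as an extended real number. -/
def poincareExponent {n : ℕ} (Γ : Subgroup (PoincareBall n ≃ₜ PoincareBall n)) : EReal :=
  sInf ((fun s : ℝ => (s : EReal)) '' {s : ℝ | 0 ≤ s ∧ poincareSeries Γ s < ⊤})

/-- The `r`-neighbourhood `F_r`: the points at Euclidean distance at most `r` from a point of
`F`. -/
def nbhd {n : ℕ} (F : Set (EuclideanSpace ℝ (Fin n))) (r : ℝ) : Set (EuclideanSpace ℝ (Fin n)) :=
  {x | ∃ y ∈ F, dist x y ≤ r}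

/-- The upper box dimension `n - liminf_{r → 0} log V_E(F_r) / log r` of a non-empty bounded set
`F ⊆ ℝⁿ`, as an extended real number. -/
def upperBoxDim {n : ℕ} (F : Set (EuclideanSpace ℝ (Fin n))) : EReal :=
  (n : EReal) -
    liminf (fun r : ℝ => ((Real.log (volume.real (nbhd F r)) / Real.log r : ℝ) : EReal)) (𝓝[>] 0)

end Kleinian

end

/-! The proof packs balls around orbit points close to the limit set `L`. Write `δ` for `1 -
|g(0)|`. Two facts are needed: `g(0)` lies within `Cδ` of `L`, and the balls of radius comparable to
`δ` about the orbit points of height about `δ` overlap boundedly. A shell with `N` elements then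
gives `N δ ^ n ≤ A · vol(L_{Bδ})` (`exists_card_mul_le`). If `t` exceeds the box dimension, the
right side is `O(δ ^ (n - t))`, so `N = O(δ ^ (-t))`, and summing over dyadic shells bounds the
Poincaré series by a geometric series for every `s > t`.

Bounded overlap follows from discreteness: elements whose balls share a point differ by a group
element moving `0` by hyperbolic distance at most `1`, and there are finitely many of these
(`finite_norm_le`).

Closeness to `L` follows from `|gx - g0| |x - g⁻¹0| ≤ 1 - |g0|²` (`norm_apply_sub_mul_le`), by
letting `x` run along the orbit to a limit point far from `g⁻¹0`. No Möbius formula for isometries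
is used: it is enough that `2 arsinh √Q`, with `Q` the point-pair invariant, bounds the distance
from below everywhere and equals it from the origin. -/

namespace Kleinian

/-! ### The point-pair invariant and its gradient. -/

section Pseudodistance

variable {E : Type*} [NormedAddCommGroup E]

/-- The point-pair invariant `|x - y|² / ((1 - |x|²)(1 - |y|²))`, which equals `sinh² (d / 2)` for
the hyperbolic distance `d` of `x` and `y`. -/
noncomputable def pairInvariant (x y : E) : ℝ :=
  ‖x - y‖ ^ 2 / ((1 - ‖x‖ ^ 2) * (1 - ‖y‖ ^ 2))

theorem one_sub_norm_sq_pos {x : E} (hx : ‖x‖ < 1) : 0 < 1 - ‖x‖ ^ 2 := by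
  nlinarith [norm_nonneg x]

theorem pairInvariant_nonneg {x y : E} (hx : ‖x‖ < 1) (hy : ‖y‖ < 1) :
    0 ≤ pairInvariant x y := by
  have := one_sub_norm_sq_pos hx
  have := one_sub_norm_sq_pos hy
  unfold pairInvariant
  positivity

theorem norm_sub_sq_le_pairInvariant {x y : E} (hx : ‖x‖ < 1) (hy : ‖y‖ < 1) :
    ‖x - y‖ ^ 2 ≤ pairInvariant x y := by
  have h1 := one_sub_norm_sq_pos hx
  have h2 := one_sub_norm_sq_pos hy
  unfold pairInvariant
  rw [le_div_iff₀ (by positivity)]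
  have : (1 - ‖x‖ ^ 2) * (1 - ‖y‖ ^ 2) ≤ 1 :=
    mul_le_one₀ (by nlinarith [sq_nonneg ‖x‖]) h2.le (by nlinarith [sq_nonneg ‖y‖])
  nlinarith [sq_nonneg ‖x - y‖]

variable [InnerProductSpace ℝ E]

theorem hasDerivAt_pairInvariant {γ : ℝ → E} {v : E} {t : ℝ} (x : E) (hx : ‖x‖ < 1)
    (hγ : HasDerivAt γ v t) (ht : ‖γ t‖ < 1) :
    HasDerivAt (fun s => pairInvariant x (γ s))
      (2 * inner ℝ ((1 - ‖γ t‖ ^ 2) • (γ t - x) + ‖x - γ t‖ ^ 2 • γ t) v /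
        ((1 - ‖x‖ ^ 2) * (1 - ‖γ t‖ ^ 2) ^ 2)) t := by
  have h1 := one_sub_norm_sq_pos hx
  have h2 := one_sub_norm_sq_pos ht
  have hnum := (hγ.const_sub x).norm_sq
  have hden := ((hγ.norm_sq).const_sub 1).const_mul (1 - ‖x‖ ^ 2)
  refine (hnum.div hden (by positivity)).congr_deriv ?_
  simp only [inner_add_left, real_inner_smul_left, inner_neg_right, inner_sub_left]
  field_simp
  ring

/-- This is the eikonal identity: it makes the hyperbolic gradient of `2 arsinh √Q` have norm one
away from `x`. -/
theorem norm_sq_gradient_pairInvariant (x z : E) :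
    ‖(1 - ‖z‖ ^ 2) • (z - x) + ‖x - z‖ ^ 2 • z‖ ^ 2 =
      ‖x - z‖ ^ 2 * (‖x - z‖ ^ 2 + (1 - ‖x‖ ^ 2) * (1 - ‖z‖ ^ 2)) := by
  have h1 : ‖x - z‖ ^ 2 = ‖x‖ ^ 2 - 2 * inner ℝ x z + ‖z‖ ^ 2 := norm_sub_sq_real x z
  have h2 : ‖z - x‖ ^ 2 = ‖x‖ ^ 2 - 2 * inner ℝ x z + ‖z‖ ^ 2 := by
    rw [norm_sub_rev, h1]
  have h3 : inner ℝ (z - x) z = ‖z‖ ^ 2 - inner ℝ x z := by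
    rw [inner_sub_left, real_inner_self_eq_norm_sq]
  rw [norm_add_sq_real, norm_smul, norm_smul, real_inner_smul_left, real_inner_smul_right, h3,
    mul_pow, mul_pow, h2, Real.norm_eq_abs, Real.norm_eq_abs, sq_abs, sq_abs, h1]
  ring

theorem deriv_pairInvariant_le {x z v : E} (hx : ‖x‖ < 1) (hz : ‖z‖ < 1) :
    2 * inner ℝ ((1 - ‖z‖ ^ 2) • (z - x) + ‖x - z‖ ^ 2 • z) v /
        ((1 - ‖x‖ ^ 2) * (1 - ‖z‖ ^ 2) ^ 2) ≤
      √(pairInvariant x z * (1 + pairInvariant x z)) * (2 * ‖v‖ / (1 - ‖z‖ ^ 2)) := by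
  have h1 := one_sub_norm_sq_pos hx
  have h2 := one_sub_norm_sq_pos hz
  have h3 : √(pairInvariant x z * (1 + pairInvariant x z)) =
      ‖(1 - ‖z‖ ^ 2) • (z - x) + ‖x - z‖ ^ 2 • z‖ / ((1 - ‖x‖ ^ 2) * (1 - ‖z‖ ^ 2)) := by
    rw [Real.sqrt_eq_iff_eq_sq]
    · rw [div_pow, norm_sq_gradient_pairInvariant]
      unfold pairInvariant
      field_simp
      ring
    · have := pairInvariant_nonneg hx hz
      positivity
    · positivity
  rw [h3, div_mul_div_comm]
  have : (1 - ‖x‖ ^ 2) * (1 - ‖z‖ ^ 2) ^ 2 =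
    (1 - ‖x‖ ^ 2) * (1 - ‖z‖ ^ 2) * (1 - ‖z‖ ^ 2) := by ring
  rw [this]
  refine div_le_div_of_nonneg_right ?_ (by positivity)
  linarith [real_inner_le_norm ((1 - ‖z‖ ^ 2) • (z - x) + ‖x - z‖ ^ 2 • z) v]

/-- The shift by `ε` avoids the singularity of the square root at `Q = 0`, which occurs at the start
of every curve. -/
theorem hasDerivAt_arsinh_sqrt {Q : ℝ → ℝ} {D t ε : ℝ} (hQ : HasDerivAt Q D t) (hε : 0 < ε)
    (h0 : 0 ≤ Q t) :
    HasDerivAt (fun s => 2 * Real.arsinh (√(Q s + ε)))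
      (D / √((Q t + ε) * (1 + (Q t + ε)))) t := by
  have hpos : 0 < Q t + ε := by positivity
  have h := (((hQ.add_const ε).sqrt hpos.ne').arsinh).const_mul 2
  refine h.congr_deriv ?_
  rw [Real.sq_sqrt hpos.le, Real.sqrt_mul hpos.le, smul_eq_mul]
  have := Real.sqrt_pos.2 hpos
  have : 0 < √(1 + (Q t + ε)) := by positivity
  field_simp

end Pseudodistance

/-! ### Bounds for the hyperbolic distance. -/

section Distance

variable {n : ℕ}

theorem norm_lt_one (x : PoincareBall n) : ‖(x : EuclideanSpace ℝ (Fin n))‖ < 1 :=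
  mem_ball_zero_iff.1 x.2

theorem continuousOn_hypLength_integrand {γ : ℝ → EuclideanSpace ℝ (Fin n)}
    (hγ : ContDiffOn ℝ 1 γ (Icc 0 1)) (hb : ∀ t ∈ Icc (0 : ℝ) 1, ‖γ t‖ < 1) :
    ContinuousOn (fun t => 2 * ‖derivWithin γ (Icc 0 1) t‖ / (1 - ‖γ t‖ ^ 2)) (Icc 0 1) := by
  have h1 := hγ.continuousOn_derivWithin (uniqueDiffOn_Icc zero_lt_one) le_rfl
  refine (continuousOn_const.mul h1.norm).div
    (continuousOn_const.sub (hγ.continuousOn.norm.pow 2)) fun t ht => ?_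
  exact (one_sub_norm_sq_pos (hb t ht)).ne'

/-- Along the curve, the derivative of `2 arsinh √(Q + ε)` is at most the hyperbolic speed.
Integrate it, then let `ε → 0`. -/
theorem arsinh_sqrt_pairInvariant_le_hypLength {γ : ℝ → EuclideanSpace ℝ (Fin n)}
    (hγ : ContDiffOn ℝ 1 γ (Icc 0 1)) (hb : ∀ t ∈ Icc (0 : ℝ) 1, ‖γ t‖ < 1) :
    2 * Real.arsinh (√(pairInvariant (γ 0) (γ 1))) ≤ hypLength γ := by
  have hb0 := hb 0 (by simp)
  have key : ∀ ε > 0, 2 * Real.arsinh (√(pairInvariant (γ 0) (γ 1) + ε)) -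
      2 * Real.arsinh (√(pairInvariant (γ 0) (γ 0) + ε)) ≤ hypLength γ := by
    intro ε hε
    refine intervalIntegral.sub_le_integral_of_hasDeriv_right_of_le
      (g := fun s => 2 * Real.arsinh (√(pairInvariant (γ 0) (γ s) + ε))) zero_le_one ?_
      (fun t ht => ?_) (continuousOn_hypLength_integrand hγ hb).integrableOn_Icc
      (fun t ht => ?_) (g' := fun t => 2 * inner ℝ ((1 - ‖γ t‖ ^ 2) • (γ t - γ 0) +
          ‖γ 0 - γ t‖ ^ 2 • γ t) (derivWithin γ (Icc 0 1) t) /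
        ((1 - ‖γ 0‖ ^ 2) * (1 - ‖γ t‖ ^ 2) ^ 2) / √((pairInvariant (γ 0) (γ t) + ε) *
          (1 + (pairInvariant (γ 0) (γ t) + ε))))
    · have hQ : ContinuousOn (fun s => pairInvariant (γ 0) (γ s)) (Icc 0 1) := by
        unfold pairInvariant
        refine ((continuousOn_const.sub hγ.continuousOn).norm.pow 2).div
          (continuousOn_const.mul (continuousOn_const.sub (hγ.continuousOn.norm.pow 2)))
          fun t ht => ?_
        exact (mul_pos (one_sub_norm_sq_pos hb0) (one_sub_norm_sq_pos (hb t ht))).ne'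
      exact continuousOn_const.mul ((hQ.add continuousOn_const).sqrt.arsinh)
    · have ht' := Ioo_subset_Icc_self ht
      have hd : HasDerivAt γ (derivWithin γ (Icc 0 1) t) t :=
        ((hγ.differentiableOn one_ne_zero t ht').hasDerivWithinAt).hasDerivAt
          (Icc_mem_nhds ht.1 ht.2)
      exact (hasDerivAt_arsinh_sqrt (hasDerivAt_pairInvariant (γ 0) hb0 hd (hb t ht')) hε
        (pairInvariant_nonneg hb0 (hb t ht'))).hasDerivWithinAt
    · have ht' := Ioo_subset_Icc_self ht
      have hQ := pairInvariant_nonneg hb0 (hb t ht')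
      have h2 := one_sub_norm_sq_pos (hb t ht')
      rw [div_le_iff₀ (by positivity), mul_comm (_ / _)]
      refine (deriv_pairInvariant_le hb0 (hb t ht')).trans ?_
      gcongr <;> linarith
  have hc : Continuous fun ε : ℝ => 2 * Real.arsinh (√(pairInvariant (γ 0) (γ 1) + ε)) -
      2 * Real.arsinh (√(pairInvariant (γ 0) (γ 0) + ε)) := by
    have := Real.continuous_arsinh
    fun_prop
  have h0 : pairInvariant (γ 0) (γ 0) = 0 := by simp [pairInvariant]
  have hlim := (hc.tendsto 0).mono_left (nhdsWithin_le_nhds (s := Ioi 0))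
  have := le_of_tendsto hlim (eventually_mem_nhdsWithin.mono fun ε hε => key ε hε)
  simpa [h0] using this

theorem hypLength_nonneg {γ : ℝ → EuclideanSpace ℝ (Fin n)}
    (hb : ∀ t ∈ Icc (0 : ℝ) 1, ‖γ t‖ < 1) : 0 ≤ hypLength γ :=
  intervalIntegral.integral_nonneg zero_le_one fun t ht => by
    have := one_sub_norm_sq_pos (hb t ht)
    positivity

theorem hypDist_le_hypLength {x y : PoincareBall n} {γ : ℝ → EuclideanSpace ℝ (Fin n)}
    (hγ : ContDiffOn ℝ 1 γ (Icc 0 1)) (hb : ∀ t ∈ Icc (0 : ℝ) 1, ‖γ t‖ < 1)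
    (h0 : γ 0 = x) (h1 : γ 1 = y) : hypDist x y ≤ hypLength γ :=
  csInf_le ⟨0, by rintro _ ⟨γ, -, hb, -, -, rfl⟩; exact hypLength_nonneg hb⟩
    ⟨γ, hγ, hb, h0, h1, rfl⟩

theorem contDiffOn_segment (x y : EuclideanSpace ℝ (Fin n)) :
    ContDiffOn ℝ 1 (fun t : ℝ => AffineMap.lineMap x y t) (Icc 0 1) := by
  simp only [AffineMap.lineMap_apply_module]
  fun_prop

theorem norm_segment_lt_one (x y : PoincareBall n) :
    ∀ t ∈ Icc (0 : ℝ) 1,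
      ‖AffineMap.lineMap (x : EuclideanSpace ℝ (Fin n)) (y : EuclideanSpace ℝ (Fin n)) t‖ < 1 := by
  intro t ht
  have := (convex_ball (0 : EuclideanSpace ℝ (Fin n)) 1).lineMap_mem x.2 y.2 ht
  simpa using this

theorem derivWithin_segment (x y : EuclideanSpace ℝ (Fin n)) {t : ℝ} (ht : t ∈ Icc (0 : ℝ) 1) :
    derivWithin (fun t : ℝ => AffineMap.lineMap x y t) (Icc 0 1) t = y - x :=
  AffineMap.hasDerivWithinAt_lineMap.derivWithin (uniqueDiffOn_Icc zero_lt_one t ht)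

theorem hypDist_le_segment (x y : PoincareBall n) : hypDist x y ≤
    ∫ t in (0 : ℝ)..1, 2 * ‖(y - x : EuclideanSpace ℝ (Fin n))‖ /
      (1 - ‖AffineMap.lineMap (x : EuclideanSpace ℝ (Fin n))
        (y : EuclideanSpace ℝ (Fin n)) t‖ ^ 2) := by
  refine (hypDist_le_hypLength (contDiffOn_segment x.1 y.1) (norm_segment_lt_one x y)
    (by simp) (by simp)).trans_eq ?_
  refine intervalIntegral.integral_congr fun t ht => ?_
  rw [uIcc_of_le zero_le_one] at ht
  simp only [derivWithin_segment _ _ ht]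

theorem arsinh_sqrt_pairInvariant_le_hypDist (x y : PoincareBall n) :
    2 * Real.arsinh (√(pairInvariant (x : EuclideanSpace ℝ (Fin n)) y)) ≤ hypDist x y := by
  refine le_csInf ⟨_, _, contDiffOn_segment x.1 y.1, norm_segment_lt_one x y, by simp, by simp,
    rfl⟩ ?_
  rintro _ ⟨γ, hγ, hb, h0, h1, rfl⟩
  rw [← h0, ← h1]
  exact arsinh_sqrt_pairInvariant_le_hypLength hγ hb

theorem pairInvariant_le_of_hypDist_le {x y : PoincareBall n} {d : ℝ} (h : hypDist x y ≤ d) :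
    pairInvariant (x : EuclideanSpace ℝ (Fin n)) y ≤ Real.sinh (d / 2) ^ 2 := by
  have h1 := (arsinh_sqrt_pairInvariant_le_hypDist x y).trans h
  have h2 : √(pairInvariant (x : EuclideanSpace ℝ (Fin n)) y) ≤ Real.sinh (d / 2) := by
    rw [← Real.sinh_arsinh (√(pairInvariant (x : EuclideanSpace ℝ (Fin n)) y)), Real.sinh_le_sinh]
    linarith
  rw [← Real.sq_sqrt (pairInvariant_nonneg (norm_lt_one x) (norm_lt_one y))]
  gcongr

theorem hypDist_comm (x y : PoincareBall n) : hypDist x y = hypDist y x := by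
  suffices h : ∀ x y : PoincareBall n, hypDist x y ≤ hypDist y x from (h x y).antisymm (h y x)
  intro x y
  refine le_csInf ⟨_, _, contDiffOn_segment y.1 x.1, norm_segment_lt_one y x, by simp, by simp,
    rfl⟩ ?_
  rintro _ ⟨γ, hγ, hb, h0, h1, rfl⟩
  have hmaps : MapsTo (fun t : ℝ => 1 - t) (Icc 0 1) (Icc 0 1) := fun t ht =>
    ⟨by linarith [ht.2], by linarith [ht.1]⟩
  refine (hypDist_le_hypLength (γ := fun t => γ (1 - t))
    (hγ.comp (by fun_prop) hmaps) (fun t ht => hb _ (hmaps ht)) (by simpa) (by simpa)).trans_eq ?_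
  unfold hypLength
  have h := intervalIntegral.integral_comp_sub_left (a := 0) (b := 1)
    (fun t => 2 * ‖derivWithin γ (Icc 0 1) t‖ / (1 - ‖γ t‖ ^ 2)) 1
  rw [sub_self, sub_zero] at h
  rw [← h]
  refine intervalIntegral.integral_congr fun t _ => ?_
  simp [derivWithin_comp_const_sub]

/-- The segment stays in the ball of radius `1 - m`, where the density is at most `2 / m`. -/
theorem hypDist_le_of_le_one_sub {x y : PoincareBall n} {m : ℝ} (hm : 0 < m)
    (hx : ‖(x : EuclideanSpace ℝ (Fin n))‖ ≤ 1 - m)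
    (hy : ‖(y : EuclideanSpace ℝ (Fin n))‖ ≤ 1 - m) :
    hypDist x y ≤ 2 * ‖(x - y : EuclideanSpace ℝ (Fin n))‖ / m := by
  refine (hypDist_le_segment x y).trans ?_
  have := intervalIntegral.norm_integral_le_of_norm_le_const (a := 0) (b := 1)
    (C := 2 * ‖(x - y : EuclideanSpace ℝ (Fin n))‖ / m)
    (f := fun t => 2 * ‖(y - x : EuclideanSpace ℝ (Fin n))‖ /
      (1 - ‖AffineMap.lineMap (x : EuclideanSpace ℝ (Fin n))
        (y : EuclideanSpace ℝ (Fin n)) t‖ ^ 2)) ?_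
  · simpa using (Real.le_norm_self _).trans this
  intro t ht
  rw [uIoc_of_le zero_le_one] at ht
  have h1 : ‖AffineMap.lineMap (x : EuclideanSpace ℝ (Fin n)) (y : EuclideanSpace ℝ (Fin n)) t‖
      ≤ 1 - m := by
    have := (convex_closedBall (0 : EuclideanSpace ℝ (Fin n)) (1 - m)).lineMap_mem
      (by simpa using hx) (by simpa using hy) (Ioc_subset_Icc_self ht)
    simpa using this
  set z := AffineMap.lineMap (x : EuclideanSpace ℝ (Fin n)) (y : EuclideanSpace ℝ (Fin n)) t
  have h2 : m ≤ 1 - ‖z‖ ^ 2 := by nlinarith [norm_nonneg z]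
  rw [norm_sub_rev, Real.norm_eq_abs, abs_of_nonneg (by have := hm.trans_le h2; positivity)]
  gcongr

theorem hypDist_origin_le (x : PoincareBall n) :
    hypDist (origin n) x ≤ Real.log ((1 + ‖(x : EuclideanSpace ℝ (Fin n))‖) /
      (1 - ‖(x : EuclideanSpace ℝ (Fin n))‖)) := by
  refine (hypDist_le_segment _ x).trans_eq ?_
  have hx := norm_lt_one x
  set r := ‖(x : EuclideanSpace ℝ (Fin n))‖ with hr
  have hr0 : 0 ≤ r := norm_nonneg _
  have hb : ∀ t ∈ uIcc (0 : ℝ) 1, 0 < 1 + t * r ∧ 0 < 1 - t * r := by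
    intro t ht
    rw [uIcc_of_le zero_le_one] at ht
    have := ht.1
    exact ⟨by positivity, by nlinarith [ht.2]⟩
  have hF : ∀ t ∈ uIcc (0 : ℝ) 1, HasDerivAt
      (fun t => Real.log (1 + t * r) - Real.log (1 - t * r)) (2 * r / (1 - (t * r) ^ 2)) t := by
    intro t ht
    obtain ⟨h1, h2⟩ := hb t ht
    have h := (((hasDerivAt_id t).mul_const r).const_add 1).log h1.ne'
    have h' := (((hasDerivAt_id t).mul_const r).const_sub 1).log h2.ne'
    refine (h.sub h').congr_deriv ?_
    have h3 : 1 - (t * r) ^ 2 = (1 + t * r) * (1 - t * r) := by ring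
    simp only [id, h3]
    rw [div_sub_div _ _ h1.ne' h2.ne']
    congr 1
    ring
  have hint := intervalIntegral.integral_eq_sub_of_hasDerivAt hF (by
    refine ContinuousOn.intervalIntegrable (continuousOn_const.div (by fun_prop) fun t ht => ?_)
    have h3 : 1 - (t * r) ^ 2 = (1 + t * r) * (1 - t * r) := by ring
    rw [h3]
    exact (mul_pos (hb t ht).1 (hb t ht).2).ne')
  rw [Real.log_div (by positivity) (by linarith)]
  simp only [one_mul, zero_mul, add_zero, sub_zero, Real.log_one] at hint
  rw [← hint]
  refine intervalIntegral.integral_congr fun t _ => ?_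
  simp [origin, AffineMap.lineMap_apply_module, norm_smul, mul_pow, ← hr]

theorem two_mul_arsinh_radial {r : ℝ} (h0 : 0 ≤ r) (h1 : r < 1) :
    2 * Real.arsinh (√(r ^ 2 / (1 - r ^ 2))) = Real.log ((1 + r) / (1 - r)) := by
  have h2 : 0 < 1 - r := by linarith
  have h3 : 1 - r ^ 2 = (1 + r) * (1 - r) := by ring
  have h4 : 0 < 1 - r ^ 2 := by rw [h3]; positivity
  have h5 : 1 + √(r ^ 2 / (1 - r ^ 2)) ^ 2 = 1 / (1 - r ^ 2) := by
    rw [Real.sq_sqrt (by positivity)]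
    field_simp
    ring
  have h6 : 0 < √(r ^ 2 / (1 - r ^ 2)) + √(1 / (1 - r ^ 2)) := by positivity
  rw [Real.arsinh, h5, two_mul, ← Real.log_mul h6.ne' h6.ne', Real.sqrt_div (by positivity),
    Real.sqrt_div (by positivity), Real.sqrt_sq h0, Real.sqrt_one, ← add_div, div_mul_div_comm,
    Real.mul_self_sqrt h4.le, h3]
  congr 1
  field_simp
  ring

theorem hypDist_origin (x : PoincareBall n) :
    hypDist (origin n) x = Real.log ((1 + ‖(x : EuclideanSpace ℝ (Fin n))‖) /
      (1 - ‖(x : EuclideanSpace ℝ (Fin n))‖)) := by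
  refine (hypDist_origin_le x).antisymm ?_
  rw [← two_mul_arsinh_radial (norm_nonneg _) (norm_lt_one x)]
  simpa [pairInvariant, origin] using arsinh_sqrt_pairInvariant_le_hypDist (origin n) x

theorem hypDist_origin_eq_arsinh (x : PoincareBall n) :
    hypDist (origin n) x = 2 * Real.arsinh (√(‖(x : EuclideanSpace ℝ (Fin n))‖ ^ 2 /
      (1 - ‖(x : EuclideanSpace ℝ (Fin n))‖ ^ 2))) := by
  rw [hypDist_origin, two_mul_arsinh_radial (norm_nonneg _) (norm_lt_one x)]

/-- Compares the lower bound at a general pair with the exact value from the origin. The isometry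
estimates below rest on this comparison. -/
theorem pairInvariant_le_of_hypDist_eq {x y z : PoincareBall n}
    (h : hypDist x y = hypDist (origin n) z) :
    pairInvariant (x : EuclideanSpace ℝ (Fin n)) y ≤
      ‖(z : EuclideanSpace ℝ (Fin n))‖ ^ 2 / (1 - ‖(z : EuclideanSpace ℝ (Fin n))‖ ^ 2) := by
  have h1 := arsinh_sqrt_pairInvariant_le_hypDist x y
  rw [h, hypDist_origin_eq_arsinh] at h1
  have h2 := one_sub_norm_sq_pos (norm_lt_one z)
  exact (Real.sqrt_le_sqrt_iff (by positivity)).1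
    (Real.arsinh_le_arsinh.1 (le_of_mul_le_mul_left h1 two_pos))

theorem norm_le_of_hypDist_origin_le {x y : PoincareBall n}
    (h : hypDist (origin n) x ≤ hypDist (origin n) y) :
    ‖(x : EuclideanSpace ℝ (Fin n))‖ ≤ ‖(y : EuclideanSpace ℝ (Fin n))‖ := by
  have hx := norm_lt_one x
  have hy := norm_lt_one y
  have h1 : 0 < 1 - ‖(x : EuclideanSpace ℝ (Fin n))‖ := by linarith
  have h2 : 0 < 1 - ‖(y : EuclideanSpace ℝ (Fin n))‖ := by linarith
  rw [hypDist_origin, hypDist_origin, Real.log_le_log_iff (by positivity) (by positivity),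
    div_le_div_iff₀ h1 h2] at h
  linarith

end Distance

end Kleinian

namespace Kleinian

/-! ### Distortion estimates for isometries. -/

section Isometry

variable {n : ℕ}

theorem norm_le_of_hypDist_origin_le_real {x : PoincareBall n} {d : ℝ}
    (h : hypDist (origin n) x ≤ d) :
    ‖(x : EuclideanSpace ℝ (Fin n))‖ ≤ 1 - Real.exp (-d) := by
  have hx := norm_lt_one x
  have h1 : 0 < 1 - ‖(x : EuclideanSpace ℝ (Fin n))‖ := by linarith
  rw [hypDist_origin, Real.log_le_iff_le_exp (by positivity), div_le_iff₀ h1] at h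
  rw [Real.exp_neg]
  have : (Real.exp d)⁻¹ ≤ 1 - ‖(x : EuclideanSpace ℝ (Fin n))‖ := by
    rw [inv_le_iff_one_le_mul₀ (Real.exp_pos d), mul_comm]
    linarith [norm_nonneg (x : EuclideanSpace ℝ (Fin n))]
  linarith

theorem norm_sub_le_of_hypDist_le {x y : PoincareBall n} {d : ℝ} (hd : 0 ≤ d)
    (h : hypDist x y ≤ d) :
    ‖(x - y : EuclideanSpace ℝ (Fin n))‖ ≤ Real.sinh (d / 2) := by
  refine (pow_le_pow_iff_left₀ (norm_nonneg _) (Real.sinh_nonneg_iff.2 (by positivity))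
    two_ne_zero).1 ?_
  exact (norm_sub_sq_le_pairInvariant (norm_lt_one x) (norm_lt_one y)).trans
    (pairInvariant_le_of_hypDist_le h)

variable {g : PoincareBall n ≃ₜ PoincareBall n}

theorem hypDist_apply_origin (hg : ∀ x y, hypDist (g x) (g y) = hypDist x y)
    (x : PoincareBall n) : hypDist (origin n) (g x) = hypDist x (g.symm (origin n)) := by
  rw [← hg x, g.apply_symm_apply, hypDist_comm]

theorem norm_symm_origin (hg : ∀ x y, hypDist (g x) (g y) = hypDist x y) :
    ‖(g.symm (origin n) : EuclideanSpace ℝ (Fin n))‖ =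
      ‖(g (origin n) : EuclideanSpace ℝ (Fin n))‖ := by
  have h := hypDist_apply_origin hg (origin n)
  exact (norm_le_of_hypDist_origin_le h.ge).antisymm (norm_le_of_hypDist_origin_le h.le)

/-- Since `d(x, g⁻¹0) = d(0, gx)`, the invariant of the first pair is at most `|gx|² / (1 - |gx|²)`;
clear denominators and use `|gx| ≤ 1`. -/
theorem one_sub_norm_sq_apply_mul_le (hg : ∀ x y, hypDist (g x) (g y) = hypDist x y)
    (x : PoincareBall n) :
    (1 - ‖(g x : EuclideanSpace ℝ (Fin n))‖ ^ 2) *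
        ‖(x - g.symm (origin n) : EuclideanSpace ℝ (Fin n))‖ ^ 2 ≤
      (1 - ‖(x : EuclideanSpace ℝ (Fin n))‖ ^ 2) *
        (1 - ‖(g (origin n) : EuclideanSpace ℝ (Fin n))‖ ^ 2) := by
  have h := pairInvariant_le_of_hypDist_eq (hypDist_apply_origin hg x).symm
  have h1 := one_sub_norm_sq_pos (norm_lt_one x)
  have h2 := one_sub_norm_sq_pos (norm_lt_one (g.symm (origin n)))
  have h3 := one_sub_norm_sq_pos (norm_lt_one (g x))
  rw [← norm_symm_origin hg]
  unfold pairInvariant at h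
  rw [div_le_div_iff₀ (by positivity) h3] at h
  nlinarith [mul_pos h1 h2]

/-- Multiply the previous estimate by the one for `d(gx, g0) = d(0, x)`: the factors `1 - |x|²` and
`1 - |gx|²` drop out, so the bound survives as `x` tends to the sphere. -/
theorem norm_apply_sub_mul_le (hg : ∀ x y, hypDist (g x) (g y) = hypDist x y)
    (x : PoincareBall n) :
    ‖(g x - g (origin n) : EuclideanSpace ℝ (Fin n))‖ *
        ‖(x - g.symm (origin n) : EuclideanSpace ℝ (Fin n))‖ ≤
      1 - ‖(g (origin n) : EuclideanSpace ℝ (Fin n))‖ ^ 2 := by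
  have h := one_sub_norm_sq_apply_mul_le hg x
  have h' := pairInvariant_le_of_hypDist_eq (x := g x) (y := g (origin n)) (z := x)
    (by rw [hg, hypDist_comm])
  have hx := norm_lt_one x
  have h1 := one_sub_norm_sq_pos hx
  have h2 := one_sub_norm_sq_pos (norm_lt_one (g (origin n)))
  have h3 := one_sub_norm_sq_pos (norm_lt_one (g x))
  unfold pairInvariant at h'
  rw [div_le_div_iff₀ (by positivity) h1] at h'
  refine (pow_le_pow_iff_left₀ (by positivity) h2.le two_ne_zero).1 ?_
  rw [mul_pow]
  set A := ‖(g x - g (origin n) : EuclideanSpace ℝ (Fin n))‖ ^ 2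
  set B := ‖(x - g.symm (origin n) : EuclideanSpace ℝ (Fin n))‖ ^ 2
  set u := 1 - ‖(x : EuclideanSpace ℝ (Fin n))‖ ^ 2 with hu
  set v := 1 - ‖(g (origin n) : EuclideanSpace ℝ (Fin n))‖ ^ 2
  set w := 1 - ‖(g x : EuclideanSpace ℝ (Fin n))‖ ^ 2
  have hB : 0 ≤ B := sq_nonneg _
  have hu1 : ‖(x : EuclideanSpace ℝ (Fin n))‖ ^ 2 ≤ 1 := by linarith
  refine le_of_mul_le_mul_left (a := u) ?_ h1
  calc u * (A * B) = (A * u) * B := by ring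
    _ ≤ (‖(x : EuclideanSpace ℝ (Fin n))‖ ^ 2 * (w * v)) * B := by gcongr
    _ ≤ (1 * (w * v)) * B := by gcongr
    _ = v * (w * B) := by ring
    _ ≤ v * (u * v) := by gcongr
    _ = u * v ^ 2 := by ring

end Isometry

/-! ### Discreteness implies local finiteness of the orbit. -/

section Discreteness

variable {n : ℕ} {Γ : Subgroup (PoincareBall n ≃ₜ PoincareBall n)}

theorem IsKleinian.hypDist_apply (hΓ : IsKleinian Γ) {g : PoincareBall n ≃ₜ PoincareBall n}
    (hg : g ∈ Γ) (x y : PoincareBall n) : hypDist (g x) (g y) = hypDist x y :=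
  (hΓ.le_conPlus hg).1 x y

theorem IsKleinian.exists_compact_forall_eq_one (hΓ : IsKleinian Γ) :
    ∃ K : Set (PoincareBall n), IsCompact K ∧ ∃ ε > 0, ∀ g ∈ Γ,
      (∀ x ∈ K, ‖(x - g x : EuclideanSpace ℝ (Fin n))‖ < ε) → g = 1 := by
  obtain ⟨U, hU, hUS⟩ := isDiscrete_iff_forall_mem_exists_isOpen.1 hΓ.isDiscrete
    ((1 : PoincareBall n ≃ₜ PoincareBall n) : C(PoincareBall n, PoincareBall n))
    ⟨1, Γ.one_mem, rfl⟩
  have h1 : ((1 : PoincareBall n ≃ₜ PoincareBall n) : C(PoincareBall n, PoincareBall n)) ∈ U :=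
    (hUS.ge (mem_singleton _)).1
  obtain ⟨⟨K, ε⟩, ⟨hK, hε⟩, hsub⟩ := (nhds_basis_uniformity'
    (Metric.uniformity_basis_dist (α := PoincareBall n)).compactConvergenceUniformity).mem_iff.1
      (hU.mem_nhds h1)
  refine ⟨K, hK, ε, hε, fun g hg hgK => ?_⟩
  have h2 : (g : C(PoincareBall n, PoincareBall n)) ∈ U := hsub fun x hx => by
    have := hgK x hx
    rwa [← dist_eq_norm] at this
  have h3 := hUS.le ⟨h2, mem_image_of_mem _ hg⟩
  ext1 x
  exact DFunLike.congr_fun h3 x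

theorem exists_norm_le_of_isCompact {K : Set (PoincareBall n)} (hK : IsCompact K) {ρ : ℝ}
    (hρ : ρ < 1) :
    ∃ r, ρ ≤ r ∧ r < 1 ∧ ∀ x ∈ K, ‖(x : EuclideanSpace ℝ (Fin n))‖ ≤ r := by
  rcases K.eq_empty_or_nonempty with rfl | hne
  · exact ⟨ρ, le_rfl, hρ, by simp⟩
  · obtain ⟨z, -, hz⟩ := hK.exists_isMaxOn hne
      (f := fun x : PoincareBall n => ‖(x : EuclideanSpace ℝ (Fin n))‖) (by fun_prop)
    exact ⟨max ρ ‖(z : EuclideanSpace ℝ (Fin n))‖, le_max_left _ _,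
      max_lt hρ (norm_lt_one z), fun x hx => (hz hx).trans (le_max_right _ _)⟩

/-- An Arzelà–Ascoli pigeonhole. These elements are equicontinuous on `K` and map it into a fixed
smaller ball, so infinitely many would include distinct `g`, `h` uniformly close on `K`. Then `h⁻¹ *
g` is near the identity there, hence trivial. -/
theorem IsKleinian.finite_norm_le (hΓ : IsKleinian Γ) {ρ : ℝ} (hρ : ρ < 1) :
    {g : PoincareBall n ≃ₜ PoincareBall n |
      g ∈ Γ ∧ ‖(g (origin n) : EuclideanSpace ℝ (Fin n))‖ ≤ ρ}.Finite := by
  obtain ⟨K, hK, ε, hε, hKε⟩ := hΓ.exists_compact_forall_eq_one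
  -- Taking `r ≥ ρ` puts the points `g⁻¹0` in the same ball as `K`.
  obtain ⟨r, hρr, hr, hKr⟩ := exists_norm_le_of_isCompact hK hρ
  obtain ⟨m, hm⟩ : ∃ m, m = 1 - r := ⟨_, rfl⟩
  have hm0 : 0 < m := by linarith
  -- Points of `K` are within `4 / m` of `g⁻¹0`, so their images stay `exp (-(4 / m))` away from the
  -- sphere.
  obtain ⟨m', hm'⟩ : ∃ m', m' = Real.exp (-(4 / m)) := ⟨_, rfl⟩
  have hm0' : 0 < m' := hm' ▸ Real.exp_pos _
  obtain ⟨δ, hδε, hδ⟩ : ∃ δ : ℝ,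
      Real.sinh ((2 * (2 * δ + 2 * Real.sinh (2 * δ / m / 2)) / m') / 2) < ε ∧ 0 < δ := by
    have hc : Continuous fun δ : ℝ =>
        Real.sinh ((2 * (2 * δ + 2 * Real.sinh (2 * δ / m / 2)) / m') / 2) := by
      have := Real.continuous_sinh
      fun_prop
    have h0 : ∀ᶠ δ in 𝓝[>] (0 : ℝ),
        Real.sinh ((2 * (2 * δ + 2 * Real.sinh (2 * δ / m / 2)) / m') / 2) < ε :=
      (hc.tendsto' 0 0 (by simp)).mono_left nhdsWithin_le_nhds |>.eventually_lt_const hε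
    exact (h0.and eventually_mem_nhdsWithin).exists
  obtain ⟨t, htK, ht, hKt⟩ := Metric.finite_approx_of_totallyBounded hK.totallyBounded δ hδ
  have := ht.fintype
  obtain ⟨T, hT, hTc⟩ := Metric.totallyBounded_iff.1
    (isCompact_closedBall (0 : t → EuclideanSpace ℝ (Fin n)) 1).totallyBounded δ hδ
  -- Each map is coded by a `δ`-approximation to its values on the finite net; equal codes mean
  -- closeness within `2δ` on the net.
  have happrox : ∀ g : PoincareBall n ≃ₜ PoincareBall n, ∃ y ∈ T,
      dist (fun i : t => (g i : EuclideanSpace ℝ (Fin n))) y < δ := fun g => by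
    have := hTc (mem_closedBall_zero_iff.2 ((pi_norm_le_iff_of_nonneg zero_le_one).2
      fun i : t => (norm_lt_one (g i)).le))
    simpa using this
  choose c hcT hc using happrox
  by_contra hinf
  obtain ⟨g, ⟨hg, hgρ⟩, h, ⟨hh, hhρ⟩, hne, hgh⟩ :=
    Set.Infinite.exists_ne_map_eq_of_mapsTo hinf (f := c) (fun g _ => hcT g) hT
  refine hne ?_
  have hlip : ∀ f ∈ Γ, ∀ x ∈ K, ∀ y ∈ K, ‖(x - y : EuclideanSpace ℝ (Fin n))‖ < δ →
      ‖(f x - f y : EuclideanSpace ℝ (Fin n))‖ ≤ Real.sinh (2 * δ / m / 2) := by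
    intro f hf x hx y hy hxy
    refine norm_sub_le_of_hypDist_le (by positivity) ?_
    rw [hΓ.hypDist_apply hf]
    refine (hypDist_le_of_le_one_sub hm0 (by linarith [hKr x hx]) (by linarith [hKr y hy])).trans ?_
    gcongr
  have hbd : ∀ f ∈ Γ, ‖(f (origin n) : EuclideanSpace ℝ (Fin n))‖ ≤ ρ → ∀ x ∈ K,
      ‖(f x : EuclideanSpace ℝ (Fin n))‖ ≤ 1 - m' := by
    intro f hf hfρ x hx
    rw [hm']
    refine norm_le_of_hypDist_origin_le_real ?_
    have hf' := hΓ.hypDist_apply hf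
    rw [hypDist_apply_origin hf']
    have ha := norm_symm_origin hf'
    refine (hypDist_le_of_le_one_sub hm0 (by linarith [hKr x hx]) (by linarith)).trans ?_
    gcongr
    linarith [norm_sub_le (x : EuclideanSpace ℝ (Fin n)) (f.symm (origin n)), hKr x hx]
  have hclose : ∀ x ∈ K, ‖(g x - h x : EuclideanSpace ℝ (Fin n))‖ ≤
      2 * δ + 2 * Real.sinh (2 * δ / m / 2) := by
    intro x hx
    obtain ⟨y, hy, hxy⟩ : ∃ y ∈ t, dist x y < δ := by simpa using hKt hx
    have hyK : y ∈ K := htK hy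
    replace hxy : ‖(x - y : EuclideanSpace ℝ (Fin n))‖ < δ := by rwa [← dist_eq_norm]
    have h1 := hlip g hg x hx y hyK hxy
    have h2 := hlip h hh x hx y hyK hxy
    have h3 : ∀ f, dist (f y : EuclideanSpace ℝ (Fin n)) (c f ⟨y, hy⟩) < δ := fun f =>
      (dist_le_pi_dist _ _ (⟨y, hy⟩ : t)).trans_lt (hc f)
    have h4 := h3 g
    have h5 := h3 h
    rw [hgh] at h4
    rw [← dist_eq_norm] at h1 h2 ⊢
    have h6 := dist_triangle4 (g x : EuclideanSpace ℝ (Fin n)) (g y) (h y) (h x)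
    have h7 := dist_triangle_right (g y : EuclideanSpace ℝ (Fin n)) (h y) (c h ⟨y, hy⟩)
    rw [dist_comm (h y : EuclideanSpace ℝ (Fin n))] at h6
    linarith
  have hone : h⁻¹ * g = 1 := by
    refine hKε _ (Γ.mul_mem (Γ.inv_mem hh) hg) fun x hx => lt_of_le_of_lt ?_ hδε
    have hs : 0 ≤ Real.sinh (2 * δ / m / 2) := Real.sinh_nonneg_iff.2 (by positivity)
    refine norm_sub_le_of_hypDist_le (by positivity) ?_
    rw [← hΓ.hypDist_apply hh]
    have h1 : h ((h⁻¹ * g) x) = g x := h.apply_symm_apply (g x)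
    rw [h1, hypDist_comm]
    refine (hypDist_le_of_le_one_sub hm0' (hbd g hg hgρ x hx) (hbd h hh hhρ x hx)).trans ?_
    gcongr
    exact hclose x hx
  exact (inv_mul_eq_one.1 hone).symm

end Discreteness

end Kleinian

namespace Kleinian

/-! ### The limit set on the sphere and its distance from orbit points. -/

section LimitSet

variable {n : ℕ} {Γ : Subgroup (PoincareBall n ≃ₜ PoincareBall n)}

theorem norm_lt_one_of_mem_orbit {p : EuclideanSpace ℝ (Fin n)} (hp : p ∈ orbit Γ) : ‖p‖ < 1 := by
  obtain ⟨g, -, rfl⟩ := hp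
  exact norm_lt_one _

theorem norm_le_one_of_mem_closure_orbit {p : EuclideanSpace ℝ (Fin n)}
    (hp : p ∈ closure (orbit Γ)) : ‖p‖ ≤ 1 := by
  have : orbit Γ ⊆ Metric.closedBall 0 1 := fun q hq =>
    mem_closedBall_zero_iff.2 (norm_lt_one_of_mem_orbit hq).le
  exact mem_closedBall_zero_iff.1 (closure_minimal this Metric.isClosed_closedBall hp)

theorem mem_limitSet_of_one_le_norm {p : EuclideanSpace ℝ (Fin n)} (hp : p ∈ closure (orbit Γ))
    (h : 1 ≤ ‖p‖) : p ∈ limitSet Γ :=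
  ⟨hp, fun h' => h.not_gt (norm_lt_one_of_mem_orbit h')⟩

theorem IsKleinian.norm_eq_one_of_mem_limitSet (hΓ : IsKleinian Γ)
    {p : EuclideanSpace ℝ (Fin n)} (hp : p ∈ limitSet Γ) : ‖p‖ = 1 := by
  refine (norm_le_one_of_mem_closure_orbit hp.1).antisymm (le_of_not_gt fun hlt => hp.2 ?_)
  obtain ⟨r, hr, hr1⟩ := exists_between hlt
  have hfin : (Metric.ball (0 : EuclideanSpace ℝ (Fin n)) r ∩ orbit Γ).Finite := by
    refine ((hΓ.finite_norm_le hr1).image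
      fun g => (g (origin n) : EuclideanSpace ℝ (Fin n))).subset ?_
    rintro _ ⟨hq, g, hg, rfl⟩
    exact ⟨g, ⟨hg, (mem_ball_zero_iff.1 hq).le⟩, rfl⟩
  have hcl := Metric.isOpen_ball.inter_closure (t := orbit Γ)
    ⟨mem_ball_zero_iff.2 hr, hp.1⟩
  rw [hfin.isClosed.closure_eq] at hcl
  exact hcl.2

/-- `η` is a subsequential limit of the images under `g` of orbit points tending to `ξ`; both
distortion estimates pass to the limit, and the first forces `|η| = 1`. -/
theorem IsKleinian.exists_mem_limitSet_norm_sub_mul_le (hΓ : IsKleinian Γ)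
    {g : PoincareBall n ≃ₜ PoincareBall n} (hg : g ∈ Γ) {ξ : EuclideanSpace ℝ (Fin n)}
    (hξ : ξ ∈ limitSet Γ) :
    ∃ η ∈ limitSet Γ, ‖η - g (origin n)‖ * ‖ξ - g.symm (origin n)‖ ≤
      1 - ‖(g (origin n) : EuclideanSpace ℝ (Fin n))‖ ^ 2 := by
  have hξ1 := hΓ.norm_eq_one_of_mem_limitSet hξ
  have hgi := hΓ.hypDist_apply hg
  obtain ⟨u, hu, huξ⟩ := mem_closure_iff_seq_limit.1 hξ.1
  choose h hhΓ hhu using hu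
  obtain ⟨η, -, φ, hφ, hη⟩ :=
    (isCompact_closedBall (0 : EuclideanSpace ℝ (Fin n)) 1).tendsto_subseq
      (x := fun k => (g (h k (origin n)) : EuclideanSpace ℝ (Fin n)))
      fun k => mem_closedBall_zero_iff.2 (norm_lt_one _).le
  have hx : Tendsto (fun k => (h (φ k) (origin n) : EuclideanSpace ℝ (Fin n))) atTop (𝓝 ξ) := by
    simpa only [Function.comp_def, hhu] using huξ.comp hφ.tendsto_atTop
  have hcl : η ∈ closure (orbit Γ) := mem_closure_of_tendsto hη
    (Eventually.of_forall fun k => ⟨g * h (φ k), Γ.mul_mem hg (hhΓ _), rfl⟩)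
  refine ⟨η, mem_limitSet_of_one_le_norm hcl ?_, ?_⟩
  · have hlim : (1 - ‖η‖ ^ 2) * ‖ξ - g.symm (origin n)‖ ^ 2 ≤
        (1 - ‖ξ‖ ^ 2) * (1 - ‖(g (origin n) : EuclideanSpace ℝ (Fin n))‖ ^ 2) :=
      le_of_tendsto_of_tendsto' (((hη.norm.pow 2).const_sub 1).mul ((hx.sub_const _).norm.pow 2))
        (((hx.norm.pow 2).const_sub 1).mul_const _)
        fun k => one_sub_norm_sq_apply_mul_le hgi (h (φ k) (origin n))
    have hpos : 0 < ‖ξ - g.symm (origin n)‖ := by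
      refine norm_pos_iff.2 (sub_ne_zero.2 fun he => ?_)
      rw [he] at hξ1
      exact (norm_lt_one _).ne hξ1
    rw [hξ1, one_pow, sub_self, zero_mul] at hlim
    by_contra hlt
    have := one_sub_norm_sq_pos (not_le.1 hlt)
    exact hlim.not_gt (by positivity)
  · exact le_of_tendsto' ((hη.sub_const _).norm.mul (hx.sub_const _).norm)
      fun k => norm_apply_sub_mul_le hgi (h (φ k) (origin n))

/-- Of two distinct limit points, one lies at least half their separation from `g⁻¹0`. -/
theorem IsKleinian.exists_norm_sub_le_mul_one_sub_norm (hΓ : IsKleinian Γ)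
    (hL : (limitSet Γ).Nontrivial) :
    ∃ C > 0, ∀ g ∈ Γ, ∃ η ∈ limitSet Γ, ‖(g (origin n) : EuclideanSpace ℝ (Fin n)) - η‖ ≤
      C * (1 - ‖(g (origin n) : EuclideanSpace ℝ (Fin n))‖) := by
  obtain ⟨ξ, hξ, ζ, hζ, hne⟩ := hL
  have hd : 0 < ‖ξ - ζ‖ := norm_pos_iff.2 (sub_ne_zero.2 hne)
  refine ⟨4 / ‖ξ - ζ‖, by positivity, fun g hg => ?_⟩
  suffices h : ∀ ω ∈ limitSet Γ, ‖ξ - ζ‖ / 2 ≤ ‖ω - g.symm (origin n)‖ → ∃ η ∈ limitSet Γ,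
      ‖(g (origin n) : EuclideanSpace ℝ (Fin n)) - η‖ ≤
        4 / ‖ξ - ζ‖ * (1 - ‖(g (origin n) : EuclideanSpace ℝ (Fin n))‖) by
    by_cases h' : ‖ξ - ζ‖ / 2 ≤ ‖ξ - g.symm (origin n)‖
    · exact h ξ hξ h'
    · refine h ζ hζ ?_
      have := norm_sub_le_norm_sub_add_norm_sub ξ (g.symm (origin n)) ζ
      rw [norm_sub_rev (Subtype.val _) ζ] at this
      linarith
  intro ω hω hωd
  obtain ⟨η, hη, h⟩ := hΓ.exists_mem_limitSet_norm_sub_mul_le hg hω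
  refine ⟨η, hη, ?_⟩
  have h1 := norm_lt_one (g (origin n))
  rw [norm_sub_rev, div_mul_eq_mul_div, le_div_iff₀ hd]
  have h2 : ‖η - g (origin n)‖ * (‖ξ - ζ‖ / 2) ≤
    ‖η - g (origin n)‖ * ‖ω - g.symm (origin n)‖ := by gcongr
  nlinarith [norm_nonneg (g (origin n) : EuclideanSpace ℝ (Fin n))]

end LimitSet

/-! ### Packing orbit points near the limit set. -/

section Counting

variable {n : ℕ} {Γ : Subgroup (PoincareBall n ≃ₜ PoincareBall n)}

-- Integrate the multiplicity function of the cover, which is at most `M`.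
open scoped Classical in
theorem sum_measure_le_card_mul_of_card_le {ι α : Type*} [MeasurableSpace α] (μ : Measure α)
    (S : Finset ι) (B : ι → Set α) (hB : ∀ i, MeasurableSet (B i)) {U : Set α} {M : ℕ}
    (hU : ∀ i ∈ S, B i ⊆ U) (hM : ∀ p, (S.filter fun i => p ∈ B i).card ≤ M) :
    ∑ i ∈ S, μ (B i) ≤ M * μ U := by
  have hV : MeasurableSet (⋃ i ∈ S, B i) := S.measurableSet_biUnion fun i _ => hB i
  calc ∑ i ∈ S, μ (B i) = ∑ i ∈ S, ∫⁻ p, (B i).indicator 1 p ∂μ := by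
        simp [hB]
    _ = ∫⁻ p, ∑ i ∈ S, (B i).indicator 1 p ∂μ :=
        (lintegral_finsetSum _ fun i _ => measurable_one.indicator (hB i)).symm
    _ ≤ ∫⁻ p, M * (⋃ i ∈ S, B i).indicator 1 p ∂μ := by
        refine lintegral_mono fun p => ?_
        by_cases hp : p ∈ ⋃ i ∈ S, B i
        · simp only [indicator_apply, Pi.one_apply, hp, if_true, mul_one, Finset.sum_boole]
          exact_mod_cast hM p
        · simp only [mem_iUnion, not_exists] at hp
          rw [Finset.sum_eq_zero fun i hi => indicator_of_notMem (hp i hi) _]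
          exact zero_le
    _ = M * μ (⋃ i ∈ S, B i) := by
        rw [lintegral_const_mul _ (measurable_one.indicator hV), lintegral_indicator_one hV]
    _ ≤ M * μ U := by
        gcongr
        exact iUnion₂_subset hU

theorem volume_real_ball (hn : n ≠ 0) (x : EuclideanSpace ℝ (Fin n)) {r : ℝ} (hr : 0 ≤ r) :
    volume.real (Metric.ball x r) =
      r ^ n * volume.real (Metric.ball (0 : EuclideanSpace ℝ (Fin n)) 1) := by
  have : NeZero n := ⟨hn⟩
  rw [Measure.real, Measure.addHaar_ball _ _ hr, ENNReal.toReal_mul,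
    ENNReal.toReal_ofReal (by positivity), finrank_euclideanSpace_fin, Measure.real]

theorem volume_real_unitBall_pos :
    0 < volume.real (Metric.ball (0 : EuclideanSpace ℝ (Fin n)) 1) :=
  ENNReal.toReal_pos (Metric.measure_ball_pos _ _ one_pos).ne' measure_ball_lt_top.ne

theorem volume_nbhd_limitSet_lt_top (Γ : Subgroup (PoincareBall n ≃ₜ PoincareBall n)) (r : ℝ) :
    volume (nbhd (limitSet Γ) r) < ⊤ := by
  refine (measure_mono ?_).trans_lt
    (measure_closedBall_lt_top (x := (0 : EuclideanSpace ℝ (Fin n))) (r := r + 1))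
  rintro x ⟨y, hy, hxy⟩
  rw [mem_closedBall_zero_iff]
  rw [dist_eq_norm] at hxy
  linarith [norm_le_norm_sub_add x y, norm_le_one_of_mem_closure_orbit hy.1]

theorem IsKleinian.exists_card_mul_le (hn : n ≠ 0) (hΓ : IsKleinian Γ)
    (hL : (limitSet Γ).Nontrivial) :
    ∃ A > 0, ∃ B > 0, ∀ δ > 0, ∀ S : Finset (PoincareBall n ≃ₜ PoincareBall n),
      (∀ g ∈ S, g ∈ Γ ∧ δ / 2 ≤ 1 - ‖(g (origin n) : EuclideanSpace ℝ (Fin n))‖ ∧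
        1 - ‖(g (origin n) : EuclideanSpace ℝ (Fin n))‖ ≤ δ) →
      S.card * δ ^ n ≤ A * volume.real (nbhd (limitSet Γ) (B * δ)) := by
  classical
  obtain ⟨C, hC, hCL⟩ := hΓ.exists_norm_sub_le_mul_one_sub_norm hL
  -- The radius `1 - exp (-1)` captures every element moving `0` by at most `1`; their number bounds
  -- the overlap.
  have hF := hΓ.finite_norm_le (ρ := 1 - Real.exp (-1)) (by linarith [Real.exp_pos (-1)])
  have hω := volume_real_unitBall_pos (n := n)
  set ω := volume.real (Metric.ball (0 : EuclideanSpace ℝ (Fin n)) 1)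
  refine ⟨8 ^ n * (hF.toFinset.card + 1) / ω, by positivity, C + 1, by positivity,
    fun δ hδ S hS => ?_⟩
  have hsum := sum_measure_le_card_mul_of_card_le volume S
    (fun g => Metric.ball (g (origin n) : EuclideanSpace ℝ (Fin n)) (δ / 8))
    (fun g => measurableSet_ball) (U := nbhd (limitSet Γ) ((C + 1) * δ))
    (M := hF.toFinset.card) ?_ ?_
  · have h1 := ENNReal.toReal_mono
      (ENNReal.mul_ne_top (by simp) (volume_nbhd_limitSet_lt_top Γ _).ne) hsum
    rw [ENNReal.toReal_sum fun g _ => measure_ball_lt_top.ne, ENNReal.toReal_mul,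
      ENNReal.toReal_natCast] at h1
    have h2 : ∀ g : PoincareBall n ≃ₜ PoincareBall n,
        (volume (Metric.ball (g (origin n) : EuclideanSpace ℝ (Fin n)) (δ / 8))).toReal =
          (δ / 8) ^ n * ω := fun g => volume_real_ball hn _ (by positivity)
    simp only [h2, Finset.sum_const, nsmul_eq_mul, div_pow] at h1
    rw [← Measure.real] at h1
    rw [div_mul_eq_mul_div, le_div_iff₀ hω]
    calc S.card * δ ^ n * ω = 8 ^ n * (S.card * (δ ^ n / 8 ^ n * ω)) := by field_simp
      _ ≤ 8 ^ n * (hF.toFinset.card * volume.real (nbhd (limitSet Γ) ((C + 1) * δ))) := by gcongr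
      _ ≤ 8 ^ n * (hF.toFinset.card + 1) * volume.real (nbhd (limitSet Γ) ((C + 1) * δ)) := by
        rw [← mul_assoc]
        gcongr
        linarith
  · intro g hg x hx
    obtain ⟨hgΓ, -, hgδ⟩ := hS g hg
    obtain ⟨η, hη, hgη⟩ := hCL g hgΓ
    refine ⟨η, hη, ?_⟩
    rw [← dist_eq_norm] at hgη
    have h1 := dist_triangle x (g (origin n)) η
    have h2 : dist x (g (origin n)) < δ / 8 := hx
    nlinarith
  · intro p
    rcases (S.filter fun g => p ∈ Metric.ball (g (origin n) : EuclideanSpace ℝ (Fin n))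
      (δ / 8)).eq_empty_or_nonempty with he | ⟨g, hg⟩
    · rw [he]
      exact Nat.zero_le _
    -- Centres of balls sharing `p` are within `δ / 4` and at depth at least `δ / 2`, hence at
    -- hyperbolic distance at most `1`. Counting group elements rather than points accounts for the
    -- stabiliser of `0`.
    · refine Finset.card_le_card_of_injOn (fun h => g⁻¹ * h) (fun h hh => ?_)
        (mul_right_injective g⁻¹).injOn
      simp only [Finset.coe_filter, Finset.mem_filter, mem_ofPred_eq, Metric.mem_ball] at hg hh
      obtain ⟨hgS, hgp⟩ := hg
      obtain ⟨hhS, hhp⟩ := hh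
      obtain ⟨hgΓ, hg1, -⟩ := hS g hgS
      obtain ⟨hhΓ, hh1, -⟩ := hS h hhS
      simp only [Finite.coe_toFinset, mem_ofPred_eq]
      refine ⟨Γ.mul_mem (Γ.inv_mem hgΓ) hhΓ, norm_le_of_hypDist_origin_le_real ?_⟩
      have h1 : g ((g⁻¹ * h) (origin n)) = h (origin n) := g.apply_symm_apply (h (origin n))
      rw [← hΓ.hypDist_apply hgΓ, h1]
      refine (hypDist_le_of_le_one_sub (m := δ / 2) (by positivity) (by linarith)
        (by linarith)).trans ?_
      rw [div_le_one (by positivity), ← dist_eq_norm]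
      linarith [dist_triangle_left (g (origin n) : EuclideanSpace ℝ (Fin n)) (h (origin n)) p]

end Counting

/-! ### Box dimension and convergence of the Poincaré series. -/

section Dimension

variable {n : ℕ} {Γ : Subgroup (PoincareBall n ≃ₜ PoincareBall n)}

theorem eventually_volume_nbhd_le_rpow {F : Set (EuclideanSpace ℝ (Fin n))} {c : ℝ}
    (hc : (c : EReal) < liminf (fun r : ℝ =>
      ((Real.log (volume.real (nbhd F r)) / Real.log r : ℝ) : EReal)) (𝓝[>] 0)) :
    ∀ᶠ r in 𝓝[>] (0 : ℝ), volume.real (nbhd F r) ≤ r ^ c := by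
  filter_upwards [eventually_lt_of_lt_liminf hc, Ioo_mem_nhdsGT one_pos] with r hr hr01
  rw [EReal.coe_lt_coe_iff, lt_div_iff_of_neg (Real.log_neg hr01.1 hr01.2)] at hr
  -- Zero volume is handled apart, since `Real.log 0 = 0` carries no information.
  rcases (measureReal_nonneg (μ := volume) (s := nbhd F r)).eq_or_lt with h | h
  · rw [← h]
    exact Real.rpow_nonneg hr01.1.le _
  · rw [← Real.log_rpow hr01.1] at hr
    exact ((Real.log_lt_log_iff h (Real.rpow_pos_of_pos hr01.1 _)).1 hr).le

/-- Each neighbourhood contains a ball of radius `r`, so its volume cannot decay faster than `r ^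
n`. This is needed because the Poincaré exponent ranges over `s ≥ 0` only. -/
theorem upperBoxDim_limitSet_nonneg (hn : n ≠ 0) (hL : (limitSet Γ).Nonempty) :
    0 ≤ upperBoxDim (limitSet Γ) := by
  refine (EReal.sub_nonneg (.inl (EReal.natCast_ne_top n)) (.inl (EReal.natCast_ne_bot n))).2 (le_of_not_gt fun hlt => ?_)
  obtain ⟨c, hnc, hc⟩ := EReal.lt_iff_exists_real_btwn.1 hlt
  replace hnc : (n : ℝ) < c := by exact_mod_cast hnc
  obtain ⟨ξ, hξ⟩ := hL
  have hω := volume_real_unitBall_pos (n := n)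
  have hev : ∀ᶠ r in 𝓝[>] (0 : ℝ),
      volume.real (Metric.ball (0 : EuclideanSpace ℝ (Fin n)) 1) ≤ r ^ (c - n) := by
    filter_upwards [eventually_volume_nbhd_le_rpow hc, eventually_mem_nhdsWithin] with r hr hr0
    rw [mem_Ioi] at hr0
    have h1 : volume.real (Metric.ball ξ r) ≤ volume.real (nbhd (limitSet Γ) r) :=
      measureReal_mono (fun x hx => ⟨ξ, hξ, (Metric.mem_ball.1 hx).le⟩)
        (volume_nbhd_limitSet_lt_top Γ r).ne
    rw [volume_real_ball hn _ hr0.le] at h1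
    rw [Real.rpow_sub hr0, Real.rpow_natCast, le_div_iff₀ (by positivity), mul_comm]
    exact h1.trans hr
  have hlim : Tendsto (fun r : ℝ => r ^ (c - n)) (𝓝[>] 0) (𝓝 0) := by
    have := (Real.continuous_rpow_const (q := c - n) (by linarith)).tendsto' 0 0
      (Real.zero_rpow (by linarith))
    exact this.mono_left nhdsWithin_le_nhds
  exact (ge_of_tendsto hlim hev).not_gt hω

theorem exp_neg_mul_hypDist_le {s : ℝ} (hs : 0 ≤ s) (x : PoincareBall n) :
    Real.exp (-s * hypDist (origin n) x) ≤ (1 - ‖(x : EuclideanSpace ℝ (Fin n))‖) ^ s := by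
  have hx := norm_lt_one x
  have h1 : 0 < 1 - ‖(x : EuclideanSpace ℝ (Fin n))‖ := by linarith
  rw [hypDist_origin, Real.rpow_def_of_pos h1, Real.log_div (by positivity) h1.ne']
  have h2 : 0 ≤ Real.log (1 + ‖(x : EuclideanSpace ℝ (Fin n))‖) :=
    Real.log_nonneg (by linarith [norm_nonneg (x : EuclideanSpace ℝ (Fin n))])
  exact Real.exp_le_exp.2 (by nlinarith [mul_nonneg hs h2])

theorem exists_shell (Γ : Subgroup (PoincareBall n ≃ₜ PoincareBall n)) :
    ∃ k : Γ → ℕ, ∀ g : Γ,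
      (1 / 2 : ℝ) ^ (k g) / 2 ≤ 1 - ‖(g.1 (origin n) : EuclideanSpace ℝ (Fin n))‖ ∧
      1 - ‖(g.1 (origin n) : EuclideanSpace ℝ (Fin n))‖ ≤ (1 / 2 : ℝ) ^ (k g) := by
  have h : ∀ g : Γ, ∃ k : ℕ,
      (1 / 2 : ℝ) ^ k / 2 ≤ 1 - ‖(g.1 (origin n) : EuclideanSpace ℝ (Fin n))‖ ∧
      1 - ‖(g.1 (origin n) : EuclideanSpace ℝ (Fin n))‖ ≤ (1 / 2 : ℝ) ^ k := fun g => by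
    obtain ⟨k, hk1, hk2⟩ := exists_nat_pow_near_of_lt_one (y := (1 / 2 : ℝ))
      (x := 1 - ‖(g.1 (origin n) : EuclideanSpace ℝ (Fin n))‖)
      (by linarith [norm_lt_one (g.1 (origin n))])
      (by linarith [norm_nonneg (g.1 (origin n) : EuclideanSpace ℝ (Fin n))])
      (by norm_num) (by norm_num)
    exact ⟨k, by rw [pow_succ] at hk1; linarith, hk2⟩
  exact ⟨fun g => (h g).choose, fun g => (h g).choose_spec⟩

theorem IsKleinian.poincareSeries_lt_top (hn : n ≠ 0) (hΓ : IsKleinian Γ)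
    (hL : (limitSet Γ).Nontrivial) {s : ℝ} (hs : 0 ≤ s) (hsD : upperBoxDim (limitSet Γ) < s) :
    poincareSeries Γ s < ⊤ := by
  obtain ⟨t, htD, hts⟩ := EReal.lt_iff_exists_real_btwn.1 hsD
  rw [EReal.coe_lt_coe_iff] at hts
  have hlim : ((n - t : ℝ) : EReal) < liminf (fun r : ℝ =>
      ((Real.log (volume.real (nbhd (limitSet Γ) r)) / Real.log r : ℝ) : EReal)) (𝓝[>] 0) := by
    unfold upperBoxDim at htD
    generalize liminf (fun r : ℝ => ((Real.log (volume.real (nbhd (limitSet Γ) r)) /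
      Real.log r : ℝ) : EReal)) (𝓝[>] 0) = ℓ at htD
    induction ℓ with
    | bot =>
      rw [EReal.sub_bot (EReal.natCast_ne_bot n)] at htD
      exact absurd htD not_top_lt
    | top => exact EReal.coe_lt_top _
    | coe a =>
      rw [EReal.coe_lt_coe_iff]
      have : (n : ℝ) - a < t := by exact_mod_cast htD
      linarith
  obtain ⟨A, hA, B, hB, hcard⟩ := hΓ.exists_card_mul_le hn hL
  obtain ⟨k, hk⟩ := exists_shell Γ
  have hfin : ∀ j, (k ⁻¹' {j}).Finite := fun j => by
    refine ((hΓ.finite_norm_le (ρ := 1 - (1 / 2 : ℝ) ^ j / 2)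
      (sub_lt_self _ (by positivity))).preimage Subtype.val_injective.injOn).subset ?_
    rintro g rfl
    exact ⟨g.2, by linarith [(hk g).1]⟩
  have hbound : ∀ j, ∑' g : k ⁻¹' {j},
      ENNReal.ofReal (Real.exp (-s * hypDist (origin n) (g.1.1 (origin n)))) ≤
        ENNReal.ofReal ((hfin j).toFinset.card * ((1 / 2 : ℝ) ^ j) ^ s) := fun j => by
    have := (hfin j).fintype
    rw [tsum_fintype, ← ENNReal.ofReal_sum_of_nonneg fun _ _ => (Real.exp_pos _).le]
    refine ENNReal.ofReal_le_ofReal ?_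
    have hc : (hfin j).toFinset.card = (Finset.univ : Finset (k ⁻¹' {j})).card := by
      rw [← Set.ncard_eq_toFinset_card _ (hfin j), Finset.card_univ, ← Nat.card_eq_fintype_card,
        Nat.card_coe_set_eq]
    rw [hc, ← nsmul_eq_mul]
    refine Finset.sum_le_card_nsmul _ _ _ fun g _ => ?_
    refine (exp_neg_mul_hypDist_le hs _).trans ?_
    have hg : k g.1 = j := g.2
    have h1 := (hk g.1).2
    rw [hg] at h1
    exact Real.rpow_le_rpow (by linarith [norm_lt_one (g.1.1 (origin n))]) h1 hs
  have hcount : ∀ j, ((hfin j).toFinset.card : ℝ) * ((1 / 2 : ℝ) ^ j) ^ n ≤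
      A * volume.real (nbhd (limitSet Γ) (B * (1 / 2 : ℝ) ^ j)) := fun j => by
    have := hcard ((1 / 2 : ℝ) ^ j) (by positivity)
      ((hfin j).toFinset.map ⟨Subtype.val, Subtype.val_injective⟩) ?_
    · rwa [Finset.card_map] at this
    · intro g hg
      simp only [Finset.mem_map, Finite.mem_toFinset, Function.Embedding.coeFn_mk] at hg
      obtain ⟨g, hg, rfl⟩ := hg
      have hg' : k g = j := hg
      have := hk g
      rw [hg'] at this
      exact ⟨g.2, this⟩
  have htend : Tendsto (fun j : ℕ => B * (1 / 2 : ℝ) ^ j) atTop (𝓝[>] 0) := by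
    refine tendsto_nhdsWithin_iff.2 ⟨?_, Eventually.of_forall fun j => by
      rw [mem_Ioi]; positivity⟩
    simpa using (tendsto_pow_atTop_nhds_zero_of_lt_one (r := (1 / 2 : ℝ)) (by norm_num)
      (by norm_num)).const_mul B
  have hsummable : Summable fun j : ℕ =>
      ((hfin j).toFinset.card : ℝ) * ((1 / 2 : ℝ) ^ j) ^ s := by
    -- Shell `j` contributes `O(δ ^ (s - t))` with `δ = 2 ^ (-j)`; the gap `t < s` makes the ratio
    -- less than one.
    have hgeom : Summable fun j : ℕ => A * B ^ (n - t) * ((1 / 2 : ℝ) ^ (s - t)) ^ j :=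
      (summable_geometric_of_lt_one (by positivity)
        (Real.rpow_lt_one (by norm_num) (by norm_num) (by linarith))).mul_left _
    refine hgeom.of_norm_bounded_eventually_nat ?_
    filter_upwards [htend.eventually (eventually_volume_nbhd_le_rpow hlim)] with j hj
    have hd : 0 < (1 / 2 : ℝ) ^ j := by positivity
    have hpow : ((1 / 2 : ℝ) ^ (s - t)) ^ j = ((1 / 2 : ℝ) ^ j) ^ (s - t) := by
      rw [← Real.rpow_natCast, ← Real.rpow_mul (by norm_num), mul_comm,
        Real.rpow_mul (by norm_num), Real.rpow_natCast]
    rw [hpow, Real.norm_of_nonneg (by positivity)]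
    have h1 := hcount j
    set d := (1 / 2 : ℝ) ^ j
    have h2 : ((hfin j).toFinset.card : ℝ) * d ^ n ≤ A * (B ^ (n - t) * d ^ (n - t)) := by
      refine h1.trans ?_
      rw [← Real.mul_rpow hB.le hd.le]
      gcongr
    have h3 : d ^ (n - t) = d ^ n * d ^ (-t) := by
      rw [sub_eq_add_neg, Real.rpow_add hd, Real.rpow_natCast]
    have h4 : ((hfin j).toFinset.card : ℝ) ≤ A * B ^ (n - t) * d ^ (-t) := by
      refine le_of_mul_le_mul_right (h2.trans_eq ?_) (pow_pos hd n)
      rw [h3]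
      ring
    calc ((hfin j).toFinset.card : ℝ) * d ^ s ≤ A * B ^ (n - t) * d ^ (-t) * d ^ s := by gcongr
      _ = A * B ^ (n - t) * d ^ (s - t) := by
        rw [mul_assoc, ← Real.rpow_add hd, neg_add_eq_sub]
  unfold poincareSeries
  rw [← ENNReal.tsum_fiberwise _ k]
  exact (ENNReal.tsum_le_tsum hbound).trans_lt hsummable.tsum_ofReal_lt_top

theorem IsKleinian.poincareExponent_le_upperBoxDim (hn : n ≠ 0) (hΓ : IsKleinian Γ)
    (hL : (limitSet Γ).Nontrivial) : poincareExponent Γ ≤ upperBoxDim (limitSet Γ) := by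
  refine EReal.le_of_forall_lt_iff_le.1 fun s hs => sInf_le ⟨s, ?_, rfl⟩
  have hs0 : 0 ≤ s := by
    exact_mod_cast (upperBoxDim_limitSet_nonneg hn hL.nonempty).trans hs.le
  exact ⟨hs0, hΓ.poincareSeries_lt_top hn hL hs0 hs⟩

end Dimension

end Kleinian

theorem mainTheorem1 (n : ℕ) (hn : 2 ≤ n)
    (Γ : Subgroup (Kleinian.PoincareBall n ≃ₜ Kleinian.PoincareBall n))
    (hΓ : Kleinian.IsKleinian Γ) (hne : Kleinian.IsNonElementary Γ) :
    Kleinian.poincareExponent Γ ≤ Kleinian.upperBoxDim (Kleinian.limitSet Γ) := by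
  refine hΓ.poincareExponent_le_upperBoxDim (by omega) (Set.one_lt_encard_iff_nontrivial.1 ?_)
  exact lt_of_lt_of_le (by norm_num) hne
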